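/- Let $N\ge 2$ and let $\widehat U$ be a nontrivial continuous irreducible unitary representation of $SU(N)$ on a finite-dimensional complex Hilbert space $V$, given by the Young tableau with row lengths $P_1\ge\dots\ge P_{N-1}\ge 0$ (that is, $\widehat U$ is equivalent to the action of $SU(N)$ on the image of the corresponding Young symmetrizer in $(\mathbb C^N)^{\otimes\sum_j P_j}$). Let $\varphi_1=\operatorname{diag}(e^{2\pi i\alpha_1},\dots,e^{2\pi i\alpha_N})$ and $\varphi_2=\operatorname{diag}(e^{2\pi i\beta_1},\dots,e^{2\pi i\beta_N})$ with real $\alpha_j,\beta_j$ and $\sum_j\alpha_j=\sum_j\beta_j=0$; they are the holonomies of two $SU(N)$ Yang–Mills vacua on the punctured plane $\mathbb R^2\setminus\{0\}$. For real $a$ let $S_a$ be the S-matrix of the Abelian Aharonov–Bohm effect with flux $2\pi a$, i.e. the operator on the momentum space $L^2(\mathbb R^2)$ which on the angular momentum subspace $H_m=\{\psi:\psi(e^{i\theta}k)=e^{im\theta}\psi(k)\ \text{for all }\theta\}$, $m\in\mathbb Z$, is multiplication by $e^{-i\pi a}$ if $m+a\ge 0$ and by $e^{i\pi a}$ if $m+a<0$.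 An S-matrix for the scattering of particles in the representation $\widehat U$ on the flux with holonomy $\varphi$ is an operator on $L^2(\mathbb R^2;V)$ of the form $\operatorname{diag}(S_{a_1},\dots,S_{a_n})$, $n=\dim V$, with respect to an orthonormal basis of $V$ in which $\widehat U(\varphi)=\operatorname{diag}(e^{2\pi i a_1},\dots,e^{2\pi i a_n})$, $a_j\in\mathbb R$ (the $a_j$ are determined up to integers, i.e. up to single-valued gauge transformations). Then the following are equivalent: 1. $\widehat U(\varphi_1)=\widehat U(\varphi_2)$; 2. the scattering is identical: the fluxes with holonomies $\varphi_1$ and $\varphi_2$ have the same S-matrices in the representation $\widehat U$; 3. $\varphi_1=\varepsilon\varphi_2$ for some $\varepsilon\in\mathbb C$ with $\varepsilon^N=1$ and $\varepsilon^{\sum_{j=1}^{N-1}P_j}=1$; 4. $\varphi_1=z\varphi_2$ for some central element $z$ of $SU(N)$ in the kernel of $\widehat U$. -/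

import Mathlib

open MeasureTheory
open scoped TensorProduct

noncomputable section

namespace AharonovBohm

/-- The gauge group `SU(N)`. -/
abbrev SU (N : ℕ) := Matrix.specialUnitaryGroup (Fin N) ℂ

/-- The diagonal holonomy `diag(e^{2πi α_1}, …, e^{2πi α_N})`, with `α_1 + ⋯ + α_N = 0`: the
non-integrable phase factor of the vacuum `A_r = 0`, `A_θ = -i diag(α_1, …, α_N)` along the loop
going once around the origin of the punctured plane. -/
def holonomy {N : ℕ} (α : Fin N → ℝ) (hα : ∑ j, α j = 0) : SU N :=
  ⟨Matrix.diagonal fun j => Complex.exp (2 * Real.pi * Complex.I * α j), by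
    have hstar : ∀ x : ℝ, Complex.exp (2 * Real.pi * Complex.I * x) *
        star (Complex.exp (2 * Real.pi * Complex.I * x)) = 1 := by
      intro x
      rw [Complex.star_def, ← Complex.exp_conj, ← Complex.exp_add]
      simp [Complex.conj_ofReal, map_ofNat]
    rw [Matrix.mem_specialUnitaryGroup_iff]
    refine ⟨?_, ?_⟩
    · rw [Matrix.mem_unitaryGroup_iff, Matrix.star_eq_conjTranspose, Matrix.diagonal_conjTranspose,
        Matrix.diagonal_mul_diagonal, ← Matrix.diagonal_one]
      congr 1
      funext j
      exact hstar (α j)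
    · rw [Matrix.det_diagonal, ← Complex.exp_sum, ← Finset.mul_sum, ← Complex.ofReal_sum, hα]
      simp⟩

/-! ### Unitary irreducible representations and Young tableaux -/

section Representations

variable {N : ℕ} {V : Type*} [NormedAddCommGroup V] [InnerProductSpace ℂ V]

/-- The linear representation underlying a unitary representation. -/
def toRepresentation (U : SU N →* (V ≃ₗᵢ[ℂ] V)) : Representation ℂ (SU N) V where
  toFun g := (U g).toLinearEquiv.toLinearMap
  map_one' := by ext v; simp
  map_mul' g h := by ext v; simp

/-- `U` is a (strongly) continuous irreducible unitary representation. -/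
structure IsUIR (U : SU N →* (V ≃ₗᵢ[ℂ] V)) : Prop where
  continuous : ∀ v : V, Continuous fun g => U g v
  irreducible : (toRepresentation U).IsIrreducible

/-- The boxes of the Young diagram whose `j`-th row has length `P j`; the box `⟨j, k⟩` stands in
row `j` and column `k`. -/
abbrev Box {r : ℕ} (P : Fin r → ℕ) : Type := (j : Fin r) × Fin (P j)

/-- The tensor power of `ℂ^N` with one factor for each box of the diagram. -/
abbrev TensorPower (N : ℕ) {r : ℕ} (P : Fin r → ℕ) : Type := ⨂[ℂ] _b : Box P, (Fin N → ℂ)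

/-- The diagonal action `g ⊗ ⋯ ⊗ g` of `SU(N)` on the tensor power. -/
def tensorAction {r : ℕ} (P : Fin r → ℕ) (g : SU N) : TensorPower N P →ₗ[ℂ] TensorPower N P :=
  PiTensorProduct.map fun _ => Matrix.toLin' (g : Matrix (Fin N) (Fin N) ℂ)

/-- The permutation of the tensor factors by a permutation of the boxes. -/
def permute (N : ℕ) {r : ℕ} (P : Fin r → ℕ) (σ : Equiv.Perm (Box P)) :
    TensorPower N P →ₗ[ℂ] TensorPower N P :=
  (PiTensorProduct.reindex ℂ (fun _ : Box P => (Fin N → ℂ)) σ).toLinearMap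

open Classical in
/-- The permutations of the boxes that preserve each row. -/
def rowPerms {r : ℕ} (P : Fin r → ℕ) : Finset (Equiv.Perm (Box P)) :=
  {σ | ∀ b, (σ b).1 = b.1}

open Classical in
/-- The permutations of the boxes that preserve each column. -/
def colPerms {r : ℕ} (P : Fin r → ℕ) : Finset (Equiv.Perm (Box P)) :=
  {σ | ∀ b, ((σ b).2 : ℕ) = (b.2 : ℕ)}

/-- The Young symmetrizer: antisymmetrize along the columns, then symmetrize along the rows. -/
def youngSymmetrizer (N : ℕ) {r : ℕ} (P : Fin r → ℕ) : TensorPower N P →ₗ[ℂ] TensorPower N P :=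
  (∑ σ ∈ rowPerms P, permute N P σ) ∘ₗ
    (∑ τ ∈ colPerms P, ((Equiv.Perm.sign τ : ℤ) : ℂ) • permute N P τ)

/-- `U` is the representation given by the Young tableau with row lengths `P_1 ≥ P_2 ≥ ⋯`: it is
equivalent to the action of `SU(N)` on the tensors of the corresponding symmetry type, i.e. on the
image of the Young symmetrizer. -/
def HasYoungTableau {r : ℕ} (U : SU N →* (V ≃ₗᵢ[ℂ] V)) (P : Fin r → ℕ) : Prop :=
  ∃ f : V ≃ₗ[ℂ] LinearMap.range (youngSymmetrizer N P),
    ∀ (g : SU N) (v : V), (f (U g v) : TensorPower N P) = tensorAction P g (f v)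

end Representations

/-! ### The scattering operator -/

/-- Wave functions in momentum representation: `L²(ℝ², dk)` with values in the internal space `V`,
the momentum plane `ℝ²` being identified with `ℂ`. -/
abbrev Momentum (V : Type*) [NormedAddCommGroup V] := Lp V 2 (volume : Measure ℂ)

/-- The rotation operator `ψ(k) ↦ ψ(c k)`, for `|c| = 1`. -/
def rotate (c : Circle) : Momentum ℂ →ₗ[ℂ] Momentum ℂ :=
  Lp.compMeasurePreservingₗ ℂ (rotation c) (rotation c).measurePreserving

/-- The angular momentum subspace `H_m`: the `ψ` with `ψ(e^{iθ} k) = e^{imθ} ψ(k)`. -/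
def angularMomentum (m : ℤ) : Submodule ℂ (Momentum ℂ) :=
  ⨅ c : Circle, Module.End.eigenspace (rotate c) ((c : ℂ) ^ m)

/-- The closed subspace spanned by the `H_m` with `λ_m = m + a ≥ 0`. -/
def nonnegAngular (a : ℝ) : Submodule ℂ (Momentum ℂ) :=
  (⨆ (m : ℤ) (_ : 0 ≤ (m : ℝ) + a), angularMomentum m).topologicalClosure

/-- The closed subspace spanned by the `H_m` with `λ_m = m + a < 0`. -/
def negAngular (a : ℝ) : Submodule ℂ (Momentum ℂ) :=
  (⨆ (m : ℤ) (_ : (m : ℝ) + a < 0), angularMomentum m).topologicalClosure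

instance (a : ℝ) : CompleteSpace (nonnegAngular a) :=
  (Submodule.isClosed_topologicalClosure _).completeSpace_coe

instance (a : ℝ) : CompleteSpace (negAngular a) :=
  (Submodule.isClosed_topologicalClosure _).completeSpace_coe

/-- The S-matrix of the electromagnetic Aharonov-Bohm effect with flux `2πa` (charge `1`): on `H_m`
it is the phase `e^{2iδ_m(a)}`, with `2δ_m(a) = -πa` if `m + a ≥ 0` and `2δ_m(a) = πa` if
`m + a < 0`. -/
def abelianSMatrix (a : ℝ) : Momentum ℂ →L[ℂ] Momentum ℂ :=
  Complex.exp (-(Real.pi * a * Complex.I)) • (nonnegAngular a).starProjection +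
    Complex.exp (Real.pi * a * Complex.I) • (negAngular a).starProjection

section SMatrix

variable {V : Type*} [NormedAddCommGroup V] [InnerProductSpace ℂ V]

/-- The operator `diag(S_{a_1}, …, S_{a_n})` on `V`-valued wave functions, with respect to the
orthonormal basis `e` of `V`: it sends `∑ ψ_j e_j` to `∑ (S_{a_j} ψ_j) e_j`. -/
def diagSMatrix {n : ℕ} (e : OrthonormalBasis (Fin n) ℂ V) (a : Fin n → ℝ) :
    Momentum V →L[ℂ] Momentum V :=
  ∑ j, ((ContinuousLinearMap.toSpanSingleton ℂ (e j)).compLpL 2 volume) ∘L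
    abelianSMatrix (a j) ∘L ((innerSL ℂ (e j)).compLpL 2 volume)

/-- `S` is an S-matrix for the scattering of particles with internal space `V` on a flux whose
holonomy acts on `V` as `T`: in an orthonormal basis with `T = diag(e^{2πi a_1}, …, e^{2πi a_n})`
one has `S = diag(S_{a_1}, …, S_{a_n})`. The fluxes `a_j` are defined by `T` up to integers only;
different choices amount to single-valued gauge transformations `e^{ikθ}` of the components. -/
def IsSMatrix (T : V ≃ₗᵢ[ℂ] V) (S : Momentum V →L[ℂ] Momentum V) : Prop :=
  ∃ (e : OrthonormalBasis (Fin (Module.finrank ℂ V)) ℂ V) (a : Fin (Module.finrank ℂ V) → ℝ),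
    (∀ j, T (e j) = Complex.exp (2 * Real.pi * Complex.I * a j) • e j) ∧ S = diagSMatrix e a

/-- Particles in the representation `U` are scattered in the same way by the fluxes with
holonomies `φ₁` and `φ₂`: the two fluxes have the same S-matrices. -/
def SameScattering {N : ℕ} (U : SU N →* (V ≃ₗᵢ[ℂ] V)) (φ₁ φ₂ : SU N) : Prop :=
  ∀ S : Momentum V →L[ℂ] Momentum V, IsSMatrix (U φ₁) S ↔ IsSMatrix (U φ₂) S

end SMatrix

end AharonovBohm

end

/-! Conditions 1, 3 and 4 are about which diagonal matrices `U` kills. A diagonal `z` multiplies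
each Young-symmetrized basis tensor by the product of the entries of `z` over its labels. Two
labelings that differ in one box, `i` against `j`, and both survive symmetrization force `d i = d j`
when `U z = 1`; so `z` is a scalar `ε` (`HasYoungTableau.diagonal_eq`). Then the determinant gives
`ε ^ N = 1`, and one surviving tensor gives `ε ^ ∑ P = 1`. Conversely, a scalar acts by `ε ^ ∑ P`.
For 1 ↔ 2, an S-matrix determines its holonomy: for large `m` all channels have `m + a_j ≥ 0`, so on
`H_m ⊗ V` the square of `S` has the phases `e^{-2πi a_j}`, which is the inverse holonomy
(`IsSMatrix.unique_holonomy`). -/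

namespace AharonovBohm

/-! ### Weights of the Young-symmetrized tensors and the kernel of `U`. -/

section Young

variable {N r : ℕ} {P : Fin r → ℕ}

/-- The basis tensor with the label `t b` at the box `b`. -/
noncomputable def basisTensor (P : Fin r → ℕ) (t : Box P → Fin N) : TensorPower N P :=
  PiTensorProduct.tprod ℂ fun b => Pi.single (t b) 1

/-- The coefficient of a tensor at the basis tensor labelled by `t`. -/
noncomputable def tensorCoeff (P : Fin r → ℕ) (t : Box P → Fin N) : TensorPower N P →ₗ[ℂ] ℂ :=
  PiTensorProduct.lift
    ((MultilinearMap.mkPiAlgebra ℂ (Box P) ℂ).compLinearMap fun b => LinearMap.proj (t b))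

theorem tensorCoeff_basisTensor (t s : Box P → Fin N) :
    tensorCoeff P t (basisTensor P s) = if s = t then 1 else 0 := by
  rw [tensorCoeff, basisTensor, PiTensorProduct.lift.tprod]
  simp only [MultilinearMap.compLinearMap_apply, MultilinearMap.mkPiAlgebra_apply,
    LinearMap.proj_apply]
  split_ifs with h
  · subst h
    simp
  · obtain ⟨b, hb⟩ := Function.ne_iff.mp h
    exact Finset.prod_eq_zero (Finset.mem_univ b) (by simp [Ne.symm hb])

theorem permute_basisTensor (σ : Equiv.Perm (Box P)) (t : Box P → Fin N) :
    permute N P σ (basisTensor P t) = basisTensor P (t ∘ σ.symm) := by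
  simp only [permute, basisTensor, LinearEquiv.coe_coe]
  exact PiTensorProduct.reindex_tprod σ _

theorem tensorAction_basisTensor (z : SU N) (d : Fin N → ℂ)
    (hz : (z : Matrix (Fin N) (Fin N) ℂ) = Matrix.diagonal d) (t : Box P → Fin N) :
    tensorAction P z (basisTensor P t) = (∏ b, d (t b)) • basisTensor P t := by
  rw [tensorAction, basisTensor, PiTensorProduct.map_tprod, ← MultilinearMap.map_smul_univ]
  congr 1
  funext b
  rw [Matrix.toLin'_apply, hz]
  ext k
  by_cases h : k = t b
  · subst h
    simp [Matrix.mulVec_diagonal]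
  · simp [Matrix.mulVec_diagonal, h]

theorem youngSymmetrizer_basisTensor (t : Box P → Fin N) :
    youngSymmetrizer N P (basisTensor P t) = ∑ σ ∈ rowPerms P, ∑ τ ∈ colPerms P,
      ((Equiv.Perm.sign τ : ℤ) : ℂ) • basisTensor P (t ∘ τ.symm ∘ σ.symm) := by
  simp only [youngSymmetrizer, LinearMap.comp_apply, LinearMap.sum_apply, LinearMap.smul_apply,
    map_sum, map_smul, permute_basisTensor, Function.comp_assoc, Finset.smul_sum]
  exact Finset.sum_comm

theorem tensorAction_youngSymmetrizer_basisTensor (z : SU N) (d : Fin N → ℂ)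
    (hz : (z : Matrix (Fin N) (Fin N) ℂ) = Matrix.diagonal d) (t : Box P → Fin N) :
    tensorAction P z (youngSymmetrizer N P (basisTensor P t)) =
      (∏ b, d (t b)) • youngSymmetrizer N P (basisTensor P t) := by
  simp only [youngSymmetrizer_basisTensor, map_sum, map_smul, Finset.smul_sum]
  refine Finset.sum_congr rfl fun σ _ => Finset.sum_congr rfl fun τ _ => ?_
  rw [tensorAction_basisTensor z d hz, smul_comm]
  have hprod : ∏ b, d ((t ∘ τ.symm ∘ σ.symm) b) = ∏ b, d (t b) :=
    (Equiv.prod_comp σ.symm fun b => d (t (τ.symm b))).trans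
      (Equiv.prod_comp τ.symm fun b => d (t b))
  rw [hprod]

/-- The coefficient of the image at `t` is a signed count of pairs `(σ, τ)` fixing `t`. Under `ht`
only `τ = 1` contributes, so no signs remain and the count is positive because of `σ = 1`. -/
theorem youngSymmetrizer_basisTensor_ne_zero (t : Box P → Fin N)
    (ht : ∀ σ ∈ rowPerms P, ∀ τ ∈ colPerms P, t ∘ τ.symm ∘ σ.symm = t → τ = 1) :
    youngSymmetrizer N P (basisTensor P t) ≠ 0 := by
  classical
  have hrow : (1 : Equiv.Perm (Box P)) ∈ rowPerms P := by simp [rowPerms]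
  have hcol : (1 : Equiv.Perm (Box P)) ∈ colPerms P := by simp [colPerms]
  intro h0
  have h := congrArg (tensorCoeff P t) h0
  simp only [youngSymmetrizer_basisTensor, map_sum, map_smul, tensorCoeff_basisTensor, map_zero,
    smul_eq_mul, mul_ite, mul_one, mul_zero] at h
  have hinner : ∀ σ ∈ rowPerms P, (∑ τ ∈ colPerms P,
      if t ∘ τ.symm ∘ σ.symm = t then ((Equiv.Perm.sign τ : ℤ) : ℂ) else 0) =
      (((if t ∘ σ.symm = t then 1 else 0 : ℕ)) : ℂ) := by
    intro σ hσ
    rw [Finset.sum_eq_single_of_mem 1 hcol]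
    · have : (t ∘ (Equiv.symm (1 : Equiv.Perm (Box P))) ∘ σ.symm) = t ∘ σ.symm := rfl
      rw [this]
      split_ifs <;> simp
    · intro τ hτ hne
      exact if_neg fun he => hne (ht σ hσ τ hτ he)
  rw [Finset.sum_congr rfl hinner, ← Nat.cast_sum, Nat.cast_eq_zero, Finset.sum_eq_zero_iff] at h
  exact absurd (h 1 hrow) (by rw [if_pos (by rfl)]; exact one_ne_zero)

theorem box_ext {b b' : Box P} (h1 : b.1 = b'.1) (h2 : (b.2 : ℕ) = b'.2) : b = b' := by
  obtain ⟨i, x⟩ := b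
  obtain ⟨j, y⟩ := b'
  dsimp only at h1 h2
  subst h1
  rw [Fin.ext h2]

theorem eq_one_of_mem_colPerms {τ : Equiv.Perm (Box P)} (hτ : τ ∈ colPerms P)
    (h : ∀ b, (τ.symm b).1 = b.1) : τ = 1 := by
  have hc : ∀ b, ((τ b).2 : ℕ) = (b.2 : ℕ) := by simpa [colPerms] using hτ
  have hs : τ.symm = 1 := by
    ext1 b
    have h2 := hc (τ.symm b)
    rw [Equiv.apply_symm_apply] at h2
    exact box_ext (h b) h2.symm
  rw [← Equiv.symm_symm τ, hs]
  rfl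

/-- A tableau with distinct constant rows is not annihilated by the Young symmetrizer. -/
theorem youngSymmetrizer_row_ne_zero {f : Fin r → Fin N} (hf : Function.Injective f) :
    youngSymmetrizer N P (basisTensor P fun b => f b.1) ≠ 0 := by
  refine youngSymmetrizer_basisTensor_ne_zero _ fun σ hσ τ hτ h => ?_
  have hr : ∀ b, (σ b).1 = b.1 := by simpa [rowPerms] using hσ
  refine eq_one_of_mem_colPerms hτ fun b => ?_
  -- Labels determine rows, so `τ⁻¹ b` lies in the row of `σ b`, which is that of `b`.
  have := congrFun h (σ b)
  simp only [Function.comp_apply, Equiv.symm_apply_apply] at this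
  rw [hf this, hr]

/-- A tableau with distinct constant rows is still not annihilated by the Young symmetrizer after
the label of one box has been replaced by a new label. -/
theorem youngSymmetrizer_update_row_ne_zero {f : Fin r → Fin N} (hf : Function.Injective f)
    (b₀ : Box P) (j : Fin N) (hj : ∀ b : Box P, f b.1 ≠ j) :
    youngSymmetrizer N P (basisTensor P (Function.update (fun b => f b.1) b₀ j)) ≠ 0 := by
  refine youngSymmetrizer_basisTensor_ne_zero _ fun σ hσ τ hτ h => ?_
  set t : Box P → Fin N := Function.update (fun b => f b.1) b₀ j with ht
  have ht0 : t b₀ = j := by simp [ht]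
  have ht1 : ∀ b, b ≠ b₀ → t b = f b.1 := fun b hb => by simp [ht, hb]
  have htj : ∀ b, t b = j → b = b₀ := fun b hb => by
    by_contra hne
    exact hj b ((ht1 b hne).symm.trans hb)
  have hr : ∀ b, (σ b).1 = b.1 := by simpa [rowPerms] using hσ
  have hc : ∀ b, ((τ b).2 : ℕ) = (b.2 : ℕ) := by simpa [colPerms] using hτ
  have key : ∀ b, t (τ.symm b) = t (σ b) := fun b => by
    simpa using congrFun h (σ b)
  -- `b₀` is the only box labelled `j`. Since `σ` keeps rows and `τ` keeps columns, both must fix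
  -- it, and the other boxes are treated as in the unmodified tableau.
  have h0 : σ (τ b₀) = b₀ := htj _ (by rw [← key, Equiv.symm_apply_apply, ht0])
  have hτ0 : τ b₀ = b₀ := box_ext (by rw [← hr (τ b₀), h0]) (hc b₀)
  have hσ0 : σ b₀ = b₀ := by rwa [hτ0] at h0
  refine eq_one_of_mem_colPerms hτ fun b => ?_
  by_cases hb : b = b₀
  · rw [hb, (Equiv.symm_apply_eq τ).mpr hτ0.symm]
  · have hb1 : τ.symm b ≠ b₀ := fun he => hb (by rw [(Equiv.symm_apply_eq τ).mp he, hτ0])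
    have hb2 : σ b ≠ b₀ := fun he => hb (σ.injective (he.trans hσ0.symm))
    have := key b
    rw [ht1 _ hb1, ht1 _ hb2] at this
    rw [hf this, hr]

theorem tensorAction_of_isEmpty [IsEmpty (Box P)] (g : SU N) : tensorAction P g = 1 := by
  refine PiTensorProduct.ext (MultilinearMap.ext fun w => ?_)
  simp only [tensorAction, LinearMap.compMultilinearMap_apply, PiTensorProduct.map_tprod,
    Module.End.one_apply]
  exact congrArg _ (Subsingleton.elim _ _)

theorem tensorAction_scalar (z : SU N) (ε : ℂ)
    (hz : (z : Matrix (Fin N) (Fin N) ℂ) = ε • 1) (w : TensorPower N P) :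
    tensorAction P z w = ε ^ (∑ j, P j) • w := by
  have : tensorAction P z = ε ^ (∑ j, P j) • (1 : TensorPower N P →ₗ[ℂ] TensorPower N P) := by
    refine PiTensorProduct.ext (MultilinearMap.ext fun w => ?_)
    simp only [tensorAction, LinearMap.compMultilinearMap_apply, PiTensorProduct.map_tprod,
      LinearMap.smul_apply, Module.End.one_apply, Matrix.toLin'_apply, hz, Matrix.smul_mulVec,
      Matrix.one_mulVec]
    rw [MultilinearMap.map_smul_univ (PiTensorProduct.tprod ℂ) (fun _ => ε) w]
    simp
  rw [this]
  rfl

variable {V : Type*} [NormedAddCommGroup V] [InnerProductSpace ℂ V] {U : SU N →* (V ≃ₗᵢ[ℂ] V)}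

theorem HasYoungTableau.exists_pos (h : HasYoungTableau U P) (hU : ∃ g, U g ≠ 1) :
    ∃ j, 0 < P j := by
  by_contra! hP
  have : IsEmpty (Box P) := ⟨fun b => absurd b.2.pos (by simpa using hP b.1)⟩
  obtain ⟨f, hf⟩ := h
  obtain ⟨g, hg⟩ := hU
  refine hg (LinearIsometryEquiv.ext fun v => f.injective (Subtype.ext ?_))
  rw [hf, tensorAction_of_isEmpty]
  rfl

theorem HasYoungTableau.tensorAction_eq_self (h : HasYoungTableau U P) {z : SU N} (hz : U z = 1)
    (w : TensorPower N P) :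
    tensorAction P z (youngSymmetrizer N P w) = youngSymmetrizer N P w := by
  obtain ⟨f, hf⟩ := h
  have := hf z (f.symm ⟨_, LinearMap.mem_range_self (youngSymmetrizer N P) w⟩)
  simpa [hz] using this.symm

theorem HasYoungTableau.prod_eq_one (h : HasYoungTableau U P) {z : SU N} (hz : U z = 1)
    {d : Fin N → ℂ} (hd : (z : Matrix (Fin N) (Fin N) ℂ) = Matrix.diagonal d)
    {t : Box P → Fin N} (ht : youngSymmetrizer N P (basisTensor P t) ≠ 0) :
    ∏ b, d (t b) = 1 := by
  have h1 := tensorAction_youngSymmetrizer_basisTensor z d hd t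
  rw [h.tensorAction_eq_self hz] at h1
  exact smul_left_injective ℂ ht (by simpa using h1.symm)

theorem HasYoungTableau.map_scalar_eq_one (h : HasYoungTableau U P) {z : SU N} {ε : ℂ}
    (hz : (z : Matrix (Fin N) (Fin N) ℂ) = ε • 1) (hε : ε ^ (∑ j, P j) = 1) : U z = 1 := by
  obtain ⟨f, hf⟩ := h
  refine LinearIsometryEquiv.ext fun v => f.injective (Subtype.ext ?_)
  rw [hf, tensorAction_scalar z ε hz, hε, one_smul]
  rfl

/-- A diagonal matrix in the kernel of a nontrivial representation with at most `N - 1` rows is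
scalar. -/
theorem HasYoungTableau.diagonal_eq (hr : r < N) (h : HasYoungTableau U P) (hU : ∃ g, U g ≠ 1)
    {z : SU N} (hz : U z = 1) {d : Fin N → ℂ}
    (hd : (z : Matrix (Fin N) (Fin N) ℂ) = Matrix.diagonal d) (i j : Fin N) : d i = d j := by
  classical
  rcases eq_or_ne i j with rfl | hij
  · rfl
  obtain ⟨k₀, hk₀⟩ := h.exists_pos hU
  -- `k` is the last nonempty row, so the label `k + 1`, available because `r < N`, is on no box.
  -- The permutation `π` below turns the labels `k`, `k + 1` into `i`, `j`.
  obtain ⟨k, hk, hmax⟩ := (Finset.univ.filter fun k => 0 < P k).exists_max_image id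
    ⟨k₀, by simpa using hk₀⟩
  have hkpos : 0 < P k := by simpa using hk
  have hmax' : ∀ b : Box P, b.1 ≤ k := fun b => hmax b.1 (by simpa using b.2.pos)
  let b₀ : Box P := ⟨k, ⟨0, hkpos⟩⟩
  let x : Fin N := Fin.castLE hr.le k
  let y : Fin N := ⟨k + 1, lt_of_le_of_lt k.2 hr⟩
  have hxy : x ≠ y := fun he => by
    have := congrArg Fin.val he
    simp [x, y] at this
  obtain ⟨π, hπx, hπy⟩ : ∃ π : Equiv.Perm (Fin N), π x = i ∧ π y = j := by
    refine ⟨(Equiv.swap x i).trans (Equiv.swap (Equiv.swap x i y) j), ?_, ?_⟩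
    · simp only [Equiv.trans_apply, Equiv.swap_apply_left]
      refine Equiv.swap_apply_of_ne_of_ne (fun he => hxy ?_) hij
      apply (Equiv.swap x i).injective
      rw [← he, Equiv.swap_apply_left]
    · simp
  let f : Fin r → Fin N := fun a => π (Fin.castLE hr.le a)
  have hf : Function.Injective f := π.injective.comp (Fin.castLE_injective hr.le)
  have hfj : ∀ b : Box P, f b.1 ≠ j := fun b he => by
    have h1 : Fin.castLE hr.le b.1 = y := π.injective (he.trans hπy.symm)
    have h2 := congrArg Fin.val h1
    have h3 : (b.1 : ℕ) ≤ k := hmax' b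
    simp only [Fin.val_castLE, y] at h2
    omega
  -- The two weights differ only in the factor at `b₀`: `d i` in one, `d j` in the other.
  have e1 := h.prod_eq_one hz hd (youngSymmetrizer_row_ne_zero (P := P) hf)
  have e2 := h.prod_eq_one hz hd (youngSymmetrizer_update_row_ne_zero hf b₀ j hfj)
  rw [Fintype.prod_eq_mul_prod_compl b₀] at e1 e2
  have e3 : ∏ b ∈ {b₀}ᶜ, d (Function.update (fun b : Box P => f b.1) b₀ j b) =
      ∏ b ∈ {b₀}ᶜ, d (f b.1) := by
    refine Finset.prod_congr rfl fun b hb => ?_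
    rw [Function.update_of_ne (by simpa using hb)]
  rw [e3, Function.update_self] at e2
  have hfi : f b₀.1 = i := hπx
  rw [hfi] at e1
  exact mul_right_cancel₀ (right_ne_zero_of_mul_eq_one e1) (e1.trans e2.symm)

end Young

/-! ### Scalar and diagonal elements of `SU(N)`. -/

section Kernel

variable {N : ℕ}

theorem holonomy_sub_mul {α β : Fin N → ℝ} (hα : ∑ j, α j = 0) (hβ : ∑ j, β j = 0)
    (h : ∑ j, (α j - β j) = 0) :
    holonomy (fun j => α j - β j) h * holonomy β hβ = holonomy α hα := by
  refine Subtype.ext ?_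
  simp only [holonomy, Submonoid.coe_mul, Matrix.diagonal_mul_diagonal, ← Complex.exp_add]
  congr 1
  funext j
  congr 1
  push_cast
  ring

theorem mem_center_of_eq_smul_one {z : SU N} {ε : ℂ}
    (hz : (z : Matrix (Fin N) (Fin N) ℂ) = ε • 1) : z ∈ Subgroup.center (SU N) := by
  refine Subgroup.mem_center_iff.mpr fun g => Subtype.ext ?_
  simp [hz]

theorem smul_one_mem_specialUnitaryGroup (hN : N ≠ 0) {ε : ℂ} (hε : ε ^ N = 1) :
    (ε • 1 : Matrix (Fin N) (Fin N) ℂ) ∈ Matrix.specialUnitaryGroup (Fin N) ℂ := by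
  rw [Matrix.mem_specialUnitaryGroup_iff, Matrix.mem_unitaryGroup_iff]
  have hn : ‖ε‖ = 1 := Complex.norm_eq_one_of_pow_eq_one hε hN
  refine ⟨?_, by simp [hε]⟩
  rw [star_smul, star_one, smul_mul_smul_comm, one_mul, Complex.star_def, Complex.mul_conj,
    Complex.normSq_eq_norm_sq, hn]
  simp

theorem prod_diagonal_eq_one {z : SU N} {d : Fin N → ℂ}
    (hd : (z : Matrix (Fin N) (Fin N) ℂ) = Matrix.diagonal d) : ∏ j, d j = 1 := by
  rw [← Matrix.det_diagonal, ← hd]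
  exact (Matrix.mem_specialUnitaryGroup_iff.mp z.2).2

end Kernel

/-! ### Unitary diagonalization and existence of S-matrices. -/

section Diagonalization

open Module End

variable {V : Type*} [NormedAddCommGroup V] [InnerProductSpace ℂ V]

theorem norm_eq_one_of_apply_eq_smul (T : V ≃ₗᵢ[ℂ] V) {μ : ℂ} {v : V} (hv : T v = μ • v)
    (hv0 : v ≠ 0) : ‖μ‖ = 1 := by
  have h := T.norm_map v
  rw [hv, norm_smul] at h
  exact mul_right_cancel₀ (norm_ne_zero_iff.mpr hv0) (h.trans (one_mul _).symm)

theorem orthogonalFamily_eigenspace (T : V ≃ₗᵢ[ℂ] V) :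
    OrthogonalFamily ℂ (fun μ : ℂ => eigenspace T.toLinearEquiv.toLinearMap μ)
      fun μ => (eigenspace T.toLinearEquiv.toLinearMap μ).subtypeₗᵢ := by
  rintro μ ν hμν ⟨v, hv⟩ ⟨w, hw⟩
  rw [mem_eigenspace_iff] at hv hw
  change T v = _ at hv
  change T w = _ at hw
  by_cases hv0 : v = 0
  · simp [hv0]
  have hμ : star μ * μ = 1 := by
    rw [Complex.star_def, Complex.conj_mul', norm_eq_one_of_apply_eq_smul T hv hv0]
    simp
  have h := T.inner_map_map v w
  rw [hv, hw, inner_smul_left, inner_smul_right] at h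
  change inner ℂ v w = 0
  by_contra hne
  rw [← mul_assoc] at h
  have h1 : star μ * ν = 1 := mul_right_cancel₀ hne (h.trans (one_mul _).symm)
  exact hμν (mul_left_cancel₀ (left_ne_zero_of_mul_eq_one hμ) (hμ.trans h1.symm))

variable [FiniteDimensional ℂ V]

/-- The complement is invariant since `T` is an isometry with nonzero eigenvalues; were it nonzero,
it would contain an eigenvector, orthogonal to itself. -/
theorem iSup_eigenspace_orthogonal (T : V ≃ₗᵢ[ℂ] V) :
    (⨆ μ : ℂ, eigenspace T.toLinearEquiv.toLinearMap μ)ᗮ = ⊥ := by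
  set T' := T.toLinearEquiv.toLinearMap with hT'
  have hinv : ∀ v ∈ (⨆ μ : ℂ, eigenspace T' μ)ᗮ, T' v ∈ (⨆ μ : ℂ, eigenspace T' μ)ᗮ := by
    intro v hv
    rw [← Submodule.iInf_orthogonal, Submodule.mem_iInf] at hv ⊢
    intro μ w hw
    by_cases hw0 : w = 0
    · simp [hw0]
    have hw' : T w = μ • w := mem_eigenspace_iff.mp hw
    have h := T.inner_map_map w v
    rw [hw', inner_smul_left, hv μ w hw] at h
    refine (mul_eq_zero.mp h).resolve_left fun h0 => hw0 ?_
    rw [map_eq_zero] at h0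
    rw [h0, zero_smul] at hw'
    simpa using hw'
  by_contra hne
  have : Nontrivial (⨆ μ : ℂ, eigenspace T' μ)ᗮ := Submodule.nontrivial_iff_ne_bot.mpr hne
  obtain ⟨μ, hμ⟩ := Module.End.exists_eigenvalue (T'.restrict hinv)
  refine hμ (eigenspace_restrict_eq_bot hinv ?_)
  exact ((Submodule.isOrtho_orthogonal_right _).mono_left
    (le_iSup (fun μ : ℂ => eigenspace T' μ) μ)).disjoint

theorem exists_orthonormalBasis_apply_eq_smul (T : V ≃ₗᵢ[ℂ] V) :
    ∃ (e : OrthonormalBasis (Fin (finrank ℂ V)) ℂ V) (μ : Fin (finrank ℂ V) → ℂ),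
      ∀ j, T (e j) = μ j • e j := by
  classical
  have hort := (orthogonalFamily_eigenspace T).comp
    (Subtype.coe_injective (p := fun μ => eigenspace T.toLinearEquiv.toLinearMap μ ≠ ⊥))
  have hint : DirectSum.IsInternal fun μ : Eigenvalues T.toLinearEquiv.toLinearMap =>
      eigenspace T.toLinearEquiv.toLinearMap μ := by
    refine hort.isInternal_iff.mpr ?_
    change (⨆ μ : {μ // eigenspace T.toLinearEquiv.toLinearMap μ ≠ ⊥},
      eigenspace T.toLinearEquiv.toLinearMap μ)ᗮ = ⊥
    rw [iSup_ne_bot_subtype, iSup_eigenspace_orthogonal]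
  exact ⟨hint.subordinateOrthonormalBasis rfl hort,
    fun j => (hint.subordinateOrthonormalBasisIndex rfl j hort).1, fun j =>
      mem_eigenspace_iff.mp (hint.subordinateOrthonormalBasis_subordinate rfl j hort)⟩

/-- Without existence, two fluxes could share all S-matrices vacuously. -/
theorem exists_isSMatrix (T : V ≃ₗᵢ[ℂ] V) : ∃ S, IsSMatrix T S := by
  obtain ⟨e, μ, h⟩ := exists_orthonormalBasis_apply_eq_smul T
  refine ⟨_, e, fun j => Complex.arg (μ j) / (2 * Real.pi), fun j => ?_, rfl⟩
  have hn := norm_eq_one_of_apply_eq_smul T (h j) (e.orthonormal.ne_zero j)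
  rw [h j]
  congr 1
  conv_lhs => rw [← Complex.norm_mul_exp_arg_mul_I (μ j), hn, Complex.ofReal_one, one_mul]
  congr 1
  push_cast
  have : (Real.pi : ℂ) ≠ 0 := by exact_mod_cast Real.pi_ne_zero
  field_simp

end Diagonalization

/-! ### Angular momentum subspaces of `L²(ℝ²)`. -/

section AngularMomentum

theorem mem_angularMomentum {m : ℤ} {ψ : Momentum ℂ} :
    ψ ∈ angularMomentum m ↔ ∀ c : Circle, rotate c ψ = (c : ℂ) ^ m • ψ := by
  simp [angularMomentum, Submodule.mem_iInf]

theorem inner_rotate (c : Circle) (ψ χ : Momentum ℂ) :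
    inner ℂ (rotate c ψ) (rotate c χ) = inner ℂ ψ χ :=
  (Lp.compMeasurePreservingₗᵢ ℂ (rotation c) (rotation c).measurePreserving).inner_map_map ψ χ

theorem exists_circle_zpow_ne_one {n : ℤ} (hn : n ≠ 0) : ∃ c : Circle, (c : ℂ) ^ n ≠ 1 := by
  -- The `n`-th power of this point is `e^{iπ} = -1`.
  refine ⟨Circle.exp (Real.pi / n), ?_⟩
  have : (n : ℂ) ≠ 0 := by exact_mod_cast hn
  rw [Circle.coe_exp, ← Complex.exp_int_mul]
  push_cast
  rw [show (n : ℂ) * (Real.pi / n * Complex.I) = Real.pi * Complex.I by field_simp,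
    Complex.exp_pi_mul_I]
  norm_num

/-- Rotations are unitary, yet rotation by `c` multiplies the inner product by `c ^ (n - m)`. -/
theorem angularMomentum_isOrtho {m n : ℤ} (hmn : m ≠ n) :
    angularMomentum m ⟂ angularMomentum n := by
  rw [Submodule.isOrtho_iff_inner_eq]
  intro ψ hψ χ hχ
  obtain ⟨c, hc⟩ := exists_circle_zpow_ne_one (sub_ne_zero.mpr hmn.symm)
  have h := inner_rotate c ψ χ
  rw [mem_angularMomentum.mp hψ c, mem_angularMomentum.mp hχ c, inner_smul_left,
    inner_smul_right, ← mul_assoc, map_zpow₀, ← Circle.coe_inv_eq_conj, Circle.coe_inv,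
    inv_zpow', ← zpow_add₀ (Circle.coe_ne_zero c), neg_add_eq_sub] at h
  by_contra hne
  exact hc (mul_right_cancel₀ hne (h.trans (one_mul _).symm))

theorem abelianSMatrix_apply_of_nonneg {m : ℤ} {a : ℝ} (h : 0 ≤ (m : ℝ) + a) {ψ : Momentum ℂ}
    (hψ : ψ ∈ angularMomentum m) :
    abelianSMatrix a ψ = Complex.exp (-(Real.pi * a * Complex.I)) • ψ := by
  have h1 : ψ ∈ nonnegAngular a := Submodule.le_topologicalClosure _
    (Submodule.mem_iSup_of_mem m (Submodule.mem_iSup_of_mem h hψ))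
  have h2 : ψ ∈ (negAngular a)ᗮ := by
    rw [negAngular, Submodule.orthogonal_closure]
    refine (Submodule.mem_orthogonal' _ _).mpr fun χ hχ => ?_
    have hle : (⨆ (n : ℤ) (_ : (n : ℝ) + a < 0), angularMomentum n) ≤ (angularMomentum m)ᗮ := by
      refine iSup₂_le fun n hn => angularMomentum_isOrtho fun he => ?_
      rw [he] at hn
      exact absurd h hn.not_ge
    exact (Submodule.mem_orthogonal _ _).mp (hle hχ) ψ hψ
  simp only [abelianSMatrix, add_apply, smul_apply]
  rw [Submodule.starProjection_eq_self_iff.mpr h1,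
    (Submodule.starProjection_apply_eq_zero_iff _).mpr h2, smul_zero, add_zero]

theorem exists_mem_angularMomentum_ne_zero (m : ℕ) :
    ∃ ψ ∈ angularMomentum m, ψ ≠ 0 := by
  -- The cutoff to the disc is rotation invariant and makes `k ^ m` square integrable.
  let f : ℂ → ℂ := (Metric.ball (0 : ℂ) 1).indicator fun k => k ^ m
  have hf : MemLp f 2 (volume : Measure ℂ) := by
    refine (memLp_indicator_iff_restrict measurableSet_ball).mpr ?_
    have : IsFiniteMeasure ((volume : Measure ℂ).restrict (Metric.ball 0 1)) :=
      ⟨by simp⟩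
    refine MemLp.of_bound (by fun_prop) 1 ?_
    filter_upwards [ae_restrict_mem measurableSet_ball] with k hk
    rw [norm_pow]
    exact pow_le_one₀ (norm_nonneg k) (by simpa using (mem_ball_zero_iff.mp hk).le)
  refine ⟨hf.toLp f, mem_angularMomentum.mpr fun c => ?_, fun h0 => ?_⟩
  · change Lp.compMeasurePreserving _ _ _ = _
    rw [Lp.toLp_compMeasurePreserving, ← MemLp.toLp_const_smul]
    refine MemLp.toLp_congr _ _ (Filter.Eventually.of_forall fun k => ?_)
    simp only [f, Function.comp_apply, rotation_apply, Pi.smul_apply, Set.indicator,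
      mem_ball_zero_iff, norm_mul, Circle.norm_coe, one_mul, smul_eq_mul, zpow_natCast, mul_pow,
      mul_ite, mul_zero]
  · have h1 : f =ᵐ[volume] 0 := hf.coeFn_toLp.symm.trans (h0 ▸ Lp.coeFn_zero _ _ _)
    have h2 : volume {k : ℂ | f k ≠ 0} = 0 := h1
    have hsub : Metric.ball (0 : ℂ) 1 ⊆ {k : ℂ | f k ≠ 0} ∪ {0} := fun k hk => by
      by_cases hk0 : k = 0
      · exact Or.inr hk0
      · left
        simp only [f, Set.mem_ofPred_eq, Set.indicator_of_mem hk]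
        exact pow_ne_zero m hk0
    have h3 : volume (Metric.ball (0 : ℂ) 1) = 0 :=
      measure_mono_null hsub (measure_union_null h2 (measure_singleton 0))
    exact (Metric.measure_ball_pos volume (0 : ℂ) one_pos).ne' h3

end AngularMomentum

/-! ### Recovering the holonomy from the S-matrix. -/

section Scattering

variable {V : Type*} [NormedAddCommGroup V] [InnerProductSpace ℂ V]

/-- The wave function `ψ ⊗ v` with internal state `v`. -/
noncomputable def internalState (ψ : Momentum ℂ) : V →ₗ[ℂ] Momentum V where
  toFun v := (ContinuousLinearMap.toSpanSingleton ℂ v).compLpL 2 volume ψ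
  map_add' v w := by
    rw [ContinuousLinearMap.toSpanSingleton_add, ContinuousLinearMap.add_compLpL]
    rfl
  map_smul' c v := by
    rw [ContinuousLinearMap.toSpanSingleton_smul, ContinuousLinearMap.smul_compLpL]
    rfl

theorem coeFn_internalState (ψ : Momentum ℂ) (v : V) :
    internalState ψ v =ᵐ[volume] fun k => ψ k • v :=
  (ContinuousLinearMap.toSpanSingleton ℂ v).coeFn_compLpL ψ

theorem internalState_injective {ψ : Momentum ℂ} (hψ : ψ ≠ 0) :
    Function.Injective (internalState (V := V) ψ) := by
  rw [injective_iff_map_eq_zero]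
  intro v hv
  by_contra hv0
  refine hψ (Lp.ext ?_)
  have h := coeFn_internalState ψ v
  rw [hv] at h
  filter_upwards [h, Lp.coeFn_zero V 2 (volume : Measure ℂ),
    Lp.coeFn_zero ℂ 2 (volume : Measure ℂ)] with k h1 h2 h3
  rw [h2] at h1
  rw [h3]
  exact (smul_eq_zero.mp h1.symm).resolve_right hv0

theorem innerSL_compLpL_internalState (ψ : Momentum ℂ) (v w : V) :
    (innerSL ℂ w).compLpL 2 volume (internalState ψ v) = (inner ℂ w v : ℂ) • ψ := by
  refine Lp.ext ?_
  filter_upwards [(innerSL ℂ w).coeFn_compLpL (p := 2) (internalState ψ v),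
    coeFn_internalState ψ v, Lp.coeFn_smul (inner ℂ w v : ℂ) ψ] with k h1 h2 h3
  rw [h1, h2, h3]
  simp [mul_comm]

theorem diagSMatrix_internalState {n : ℕ} (e : OrthonormalBasis (Fin n) ℂ V) (a : Fin n → ℝ)
    {m : ℤ} (hm : ∀ j, 0 ≤ (m : ℝ) + a j) {ψ : Momentum ℂ} (hψ : ψ ∈ angularMomentum m)
    (i : Fin n) :
    diagSMatrix e a (internalState ψ (e i)) =
      Complex.exp (-(Real.pi * a i * Complex.I)) • internalState ψ (e i) := by
  simp only [diagSMatrix, sum_apply, ContinuousLinearMap.comp_apply,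
    innerSL_compLpL_internalState, map_smul]
  rw [Finset.sum_eq_single i]
  · rw [abelianSMatrix_apply_of_nonneg (hm i) hψ, map_smul]
    simp [internalState]
  · intro j _ hj
    rw [e.inner_eq_zero hj, zero_smul]
  · simp

/-- In the sectors of large angular momentum the square of an S-matrix is the inverse of the
holonomy. -/
theorem IsSMatrix.apply_apply_internalState {T : V ≃ₗᵢ[ℂ] V} {S : Momentum V →L[ℂ] Momentum V}
    (h : IsSMatrix T S) : ∀ᶠ m : ℕ in Filter.atTop, ∀ ψ ∈ angularMomentum m, ∀ v,
      S (S (internalState ψ (T v))) = internalState ψ v := by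
  obtain ⟨e, a, hT, rfl⟩ := h
  have hlarge : ∀ᶠ m : ℕ in Filter.atTop, ∀ j, -a j ≤ (m : ℝ) :=
    Filter.eventually_all.mpr fun j => tendsto_natCast_atTop_atTop.eventually_ge_atTop (-a j)
  filter_upwards [hlarge] with m hm ψ hψ v
  have hm' : ∀ j, 0 ≤ ((m : ℤ) : ℝ) + a j := fun j => by
    have := hm j
    push_cast
    linarith
  have key : (diagSMatrix e a).toLinearMap ∘ₗ (diagSMatrix e a).toLinearMap ∘ₗ
      internalState ψ ∘ₗ T.toLinearEquiv.toLinearMap = internalState ψ := by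
    refine e.toBasis.ext fun i => ?_
    rw [OrthonormalBasis.coe_toBasis]
    change diagSMatrix e a (diagSMatrix e a (internalState ψ (T (e i)))) = _
    rw [hT, map_smul, map_smul, map_smul, diagSMatrix_internalState e a hm' hψ, map_smul,
      diagSMatrix_internalState e a hm' hψ, smul_smul, smul_smul, ← Complex.exp_add,
      ← Complex.exp_add]
    -- Two factors `e^{-πi a_i}` from `S` cancel `e^{2πi a_i}` from `T`.
    convert one_smul ℂ _
    rw [← Complex.exp_zero]
    congr 1
    ring
  exact LinearMap.congr_fun key v

theorem IsSMatrix.unique_holonomy {T₁ T₂ : V ≃ₗᵢ[ℂ] V} {S : Momentum V →L[ℂ] Momentum V}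
    (h₁ : IsSMatrix T₁ S) (h₂ : IsSMatrix T₂ S) : T₁ = T₂ := by
  obtain ⟨m, hm₁, hm₂⟩ := (h₁.apply_apply_internalState.and h₂.apply_apply_internalState).exists
  obtain ⟨ψ, hψ, hψ0⟩ := exists_mem_angularMomentum_ne_zero m
  ext v
  have e₁ := hm₁ ψ hψ v
  -- With this vector both identities evaluate `S` twice on the same state `ψ ⊗ T₁ v`.
  have e₂ := hm₂ ψ hψ (T₂.symm (T₁ v))
  rw [LinearIsometryEquiv.apply_symm_apply, e₁] at e₂
  exact (T₂.symm_apply_eq.mp (internalState_injective hψ0 e₂).symm)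

theorem sameScattering_iff [FiniteDimensional ℂ V] {N : ℕ} (U : SU N →* (V ≃ₗᵢ[ℂ] V))
    (φ₁ φ₂ : SU N) : SameScattering U φ₁ φ₂ ↔ U φ₁ = U φ₂ := by
  refine ⟨fun h => ?_, fun h S => by rw [h]⟩
  obtain ⟨S, hS⟩ := exists_isSMatrix (U φ₁)
  exact hS.unique_holonomy ((h S).mp hS)

end Scattering

end AharonovBohm

theorem theorem2 (N : ℕ) (hN : 2 ≤ N)
    {V : Type*} [NormedAddCommGroup V] [InnerProductSpace ℂ V] [FiniteDimensional ℂ V]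
    (U : AharonovBohm.SU N →* (V ≃ₗᵢ[ℂ] V)) (hU : AharonovBohm.IsUIR U) (hU1 : ∃ g, U g ≠ 1)
    (P : Fin (N - 1) → ℕ) (hP : Antitone P) (hUP : AharonovBohm.HasYoungTableau U P)
    (α β : Fin N → ℝ) (hα : ∑ j, α j = 0) (hβ : ∑ j, β j = 0)
    (φ₁ φ₂ : AharonovBohm.SU N)
    (hφ₁ : φ₁ = AharonovBohm.holonomy α hα) (hφ₂ : φ₂ = AharonovBohm.holonomy β hβ) :
    [ U φ₁ = U φ₂,
      AharonovBohm.SameScattering U φ₁ φ₂,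
      ∃ ε : ℂ, ε ^ N = 1 ∧ ε ^ (∑ j, P j) = 1 ∧
        (φ₁ : Matrix (Fin N) (Fin N) ℂ) = ε • (φ₂ : Matrix (Fin N) (Fin N) ℂ),
      ∃ z ∈ Subgroup.center (AharonovBohm.SU N), U z = 1 ∧ φ₁ = z * φ₂ ].TFAE := by
  have hr : N - 1 < N := by omega
  tfae_have 1 ↔ 2 := (AharonovBohm.sameScattering_iff U φ₁ φ₂).symm
  tfae_have 1 → 3 := by
    intro h
    have hsum : ∑ j, (α j - β j) = 0 := by rw [Finset.sum_sub_distrib, hα, hβ, sub_zero]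
    set z := AharonovBohm.holonomy (fun j => α j - β j) hsum
    have hzφ : z * φ₂ = φ₁ := by
      rw [hφ₁, hφ₂, AharonovBohm.holonomy_sub_mul hα hβ hsum]
    have hz : U z = 1 := by
      rw [← hzφ, map_mul] at h
      exact mul_eq_right.mp h
    obtain ⟨d, hd⟩ : ∃ d, (z : Matrix (Fin N) (Fin N) ℂ) = Matrix.diagonal d := ⟨_, rfl⟩
    have hdε : ∀ j, d j = d ⟨0, by omega⟩ := fun j => hUP.diagonal_eq hr hU1 hz hd j _
    refine ⟨d ⟨0, by omega⟩, ?_, ?_, ?_⟩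
    · simpa [hdε] using AharonovBohm.prod_diagonal_eq_one hd
    -- The tableau with constant rows has one factor `ε` per box, hence the exponent `∑ P j`.
    · simpa [hdε] using hUP.prod_eq_one hz hd
        (AharonovBohm.youngSymmetrizer_row_ne_zero (Fin.castLE_injective hr.le))
    · rw [← hzφ, Submonoid.coe_mul, hd, funext hdε, ← Matrix.smul_one_eq_diagonal, smul_mul_assoc,
        one_mul]
  tfae_have 3 → 4 := by
    rintro ⟨ε, hε, hεP, h⟩
    let z : AharonovBohm.SU N :=
      ⟨ε • 1, AharonovBohm.smul_one_mem_specialUnitaryGroup (by omega) hε⟩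
    refine ⟨z, AharonovBohm.mem_center_of_eq_smul_one rfl,
      hUP.map_scalar_eq_one (z := z) rfl hεP, Subtype.ext ?_⟩
    rw [Submonoid.coe_mul, h, smul_mul_assoc, one_mul]
  tfae_have 4 → 1 := by
    rintro ⟨z, -, hz, rfl⟩
    rw [map_mul, hz, one_mul]
  tfae_finish
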